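/- Let $\mathcal X$ be a non-empty set. A gamble on $\mathcal X$ is a bounded function $f\colon\mathcal X\to\mathbb R$; let $\mathcal G(\mathcal X)$ be the set of all gambles and let $\mathcal C(\mathcal X)$ be the set of all pairs $(f,B)$ with $f\in\mathcal G(\mathcal X)$ and $\emptyset\neq B\subseteq\mathcal X$. A coherent set of desirable gambles is a set $\mathcal D\subseteq\mathcal G(\mathcal X)$ such that, for all $f,g\in\mathcal G(\mathcal X)$ and all real $\lambda>0$: (D1) if $f\ge 0$ and $f\ne 0$, then $f\in\mathcal D$; (D2) if $f\in\mathcal D$, then $\lambda f\in\mathcal D$; (D3) if $f,g\in\mathcal D$, then $f+g\in\mathcal D$; (D4) if $f\le 0$, then $f\notin\mathcal D$. A conditional lower prevision on $\mathcal C\subseteq\mathcal C(\mathcal X)$ is a map $\underline P\colon\mathcal C\to\mathbb R\cup\{-\infty,+\infty\}$, $(f,B)\mapsto\underline P(f\vert B)$. It is coherent if there is a coherent set of desirable gambles $\mathcal D$ such that $$\underline P(f\vert B)=\sup\{\mu\in\mathbb R\colon [f-\mu]\mathbb I_B\in\mathcal D\}\quad\text{for all }(f,B)\in\mathcal C,$$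 where $\mathbb I_B$ is the indicator of $B$ and the supremum is taken in the extended reals. A conditional linear prevision on $\mathcal C(\mathcal X)$ is a coherent conditional lower prevision $P$ on $\mathcal C(\mathcal X)$ such that $P(f\vert B)=-P(-f\vert B)$ for all $(f,B)\in\mathcal C(\mathcal X)$. Proposition. Let $\mathcal C\subseteq\mathcal C(\mathcal X)$ be arbitrary and let $\underline P$ be a conditional lower prevision on $\mathcal C$. Then $\underline P$ is coherent if and only if there is a non-empty set $\mathbb P$ of conditional linear previsions on $\mathcal C(\mathcal X)$ such that $$\underline P(f\vert B)=\inf\{P(f\vert B)\colon P\in\mathbb P\}\quad\text{for all }(f,B)\in\mathcal C.$$ The same is true if the infimum is replaced by a minimum: $\underline P$ is coherent if and only if there is a non-empty set $\mathbb P$ of conditional linear previsions on $\mathcal C(\mathcal X)$ such that, for all $(f,B)\in\mathcal C$, the set $\{P(f\vert B)\colon P\in\mathbb P\}$ has a minimum and this minimum equals $\underline P(f\vert B)$. -/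

import Mathlib

namespace CondPrev

/-- The real vector space of gambles on `X`: the bounded real-valued functions on `X`. -/
def Gamble (X : Type*) : Submodule ℝ (X → ℝ) where
  carrier := {f | ∃ M : ℝ, ∀ x, |f x| ≤ M}
  add_mem' := by
    rintro f g ⟨M, hM⟩ ⟨N, hN⟩
    exact ⟨M + N, fun x => (abs_add_le (f x) (g x)).trans (add_le_add (hM x) (hN x))⟩
  zero_mem' := ⟨0, fun x => by simp⟩
  smul_mem' := by
    rintro c f ⟨M, hM⟩
    refine ⟨|c| * M, fun x => ?_⟩
    simpa [abs_mul] using mul_le_mul_of_nonneg_left (hM x) (abs_nonneg c)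

/-- The called-off gamble `[f - μ] I_B`, equal to `f x - μ` for `x ∈ B` and to `0` elsewhere. -/
noncomputable def calledOff {X : Type*} (f : Gamble X) (μ : ℝ) (B : Set X) : Gamble X :=
  ⟨B.indicator (fun x => (f : X → ℝ) x - μ), by
    obtain ⟨M, hM⟩ := f.2
    refine ⟨M + |μ|, fun x => ?_⟩
    have h : |(f : X → ℝ) x - μ| ≤ M + |μ| :=
      (abs_sub _ _).trans (add_le_add (hM x) le_rfl)
    by_cases hx : x ∈ B
    · simpa [Set.indicator_of_mem hx] using h
    · simpa [Set.indicator_of_notMem hx] using (abs_nonneg _).trans h⟩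

/-- Coherent sets of desirable gambles. -/
structure IsCoherentSet {X : Type*} (D : Set (Gamble X)) : Prop where
  gain : ∀ f : Gamble X, (∀ x, 0 ≤ (f : X → ℝ) x) → f ≠ 0 → f ∈ D
  scale : ∀ f ∈ D, ∀ c : ℝ, 0 < c → c • f ∈ D
  add : ∀ f ∈ D, ∀ g ∈ D, f + g ∈ D
  loss : ∀ f : Gamble X, (∀ x, (f : X → ℝ) x ≤ 0) → f ∉ D

/-- The set `C(X)` of all pairs `(f, B)` of a gamble `f` on `X` and a non-empty event `B ⊆ X`. -/
abbrev CondPair (X : Type*) : Type _ := Gamble X × {B : Set X // B.Nonempty}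

/-- Conditional lower previsions on a domain `C ⊆ C(X)`: extended-real-valued maps on `C`. -/
abbrev CondLowerPrevision {X : Type*} (C : Set (CondPair X)) : Type _ := C → EReal

/-- The conditional lower prevision on `C(X)` derived from a set of gambles `D`:
`sup {μ ∈ ℝ : [f - μ] I_B ∈ D}`, in the extended reals. -/
noncomputable def lowerOf {X : Type*} (D : Set (Gamble X)) (p : CondPair X) : EReal :=
  sSup ((fun μ : ℝ => (μ : EReal)) '' {μ : ℝ | calledOff p.1 μ p.2.1 ∈ D})

/-- A conditional lower prevision is coherent if it is derived from a coherent set of gambles. -/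
def IsCoherent {X : Type*} {C : Set (CondPair X)} (P : CondLowerPrevision C) : Prop :=
  ∃ D : Set (Gamble X), IsCoherentSet D ∧ ∀ p : C, P p = lowerOf D p.1

/-- A conditional prevision is a self-conjugate conditional lower prevision. -/
def IsSelfConjugate {X : Type*} {C : Set (CondPair X)} (P : CondLowerPrevision C) : Prop :=
  ∀ p : C, ∃ h : (-p.1.1, p.1.2) ∈ C, P p = -P ⟨(-p.1.1, p.1.2), h⟩

/-- A conditional linear prevision is a coherent conditional prevision. -/
def IsLinearPrevision {X : Type*} {C : Set (CondPair X)} (P : CondLowerPrevision C) : Prop :=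
  IsSelfConjugate P ∧ IsCoherent P

/-- Conditional lower previsions on the full domain `C(X)`. -/
abbrev FullCondLowerPrevision (X : Type*) : Type _ :=
  CondLowerPrevision (Set.univ : Set (CondPair X))

end CondPrev

namespace CondPrev

variable {X : Type*}

/-! Complete coherent sets, those containing `f` or `-f` for every nonzero `f`, induce linear
previsions. Zorn's lemma completes any coherent set. To attain the value of `lowerOf D` at a fixed
pair, the negatives of the called-off gambles at all higher prices are adjoined to `D` before
completing: no completion can then raise that value, while monotonicity prevents lowering it
(`exists_complete_superset_lowerOf_eq`). Conversely, intersections of coherent sets are coherent,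
and intersecting them turns the derived lower previsions into their infimum
(`isCoherent_of_eq_sInf`). -/

theorem calledOff_apply_of_mem (f : Gamble X) (μ : ℝ) {B : Set X} {x : X} (hx : x ∈ B) :
    (calledOff f μ B : X → ℝ) x = (f : X → ℝ) x - μ :=
  Set.indicator_of_mem hx fun x => (f : X → ℝ) x - μ

theorem calledOff_apply_of_notMem (f : Gamble X) (μ : ℝ) {B : Set X} {x : X} (hx : x ∉ B) :
    (calledOff f μ B : X → ℝ) x = 0 :=
  Set.indicator_of_notMem hx fun x => (f : X → ℝ) x - μ

theorem calledOff_neg (f : Gamble X) (μ : ℝ) (B : Set X) :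
    calledOff (-f) (-μ) B = -calledOff f μ B := by
  ext x
  by_cases hx : x ∈ B
  · simp only [Submodule.coe_neg, Pi.neg_apply, calledOff_apply_of_mem _ _ hx]
    ring
  · simp [calledOff_apply_of_notMem _ _ hx]

/-- Called-off gambles at different prices differ by a multiple of the indicator of `B`. -/
theorem calledOff_eq_add (f : Gamble X) (μ ν : ℝ) (B : Set X) :
    calledOff f μ B = calledOff f ν B + calledOff 0 (μ - ν) B := by
  ext x
  by_cases hx : x ∈ B
  · simp only [Submodule.coe_add, Pi.add_apply, calledOff_apply_of_mem _ _ hx,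
      Submodule.coe_zero, Pi.zero_apply]
    ring
  · simp [calledOff_apply_of_notMem _ _ hx]

theorem smul_calledOff_add_smul_calledOff (f : Gamble X) (B : Set X) (μ ν : ℝ) {c d : ℝ}
    (h : c + d ≠ 0) :
    c • calledOff f μ B + d • calledOff f ν B =
      (c + d) • calledOff f ((c * μ + d * ν) / (c + d)) B := by
  ext x
  by_cases hx : x ∈ B
  · simp only [Submodule.coe_add, Submodule.coe_smul, Pi.add_apply, Pi.smul_apply, smul_eq_mul,
      calledOff_apply_of_mem _ _ hx]
    field_simp
    ring
  · simp [calledOff_apply_of_notMem _ _ hx]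

namespace IsCoherentSet

variable {D : Set (Gamble X)}

theorem zero_notMem (hD : IsCoherentSet D) : (0 : Gamble X) ∉ D :=
  hD.loss 0 fun _ => le_rfl

theorem neg_notMem (hD : IsCoherentSet D) {f : Gamble X} (hf : f ∈ D) : -f ∉ D := fun h =>
  hD.zero_notMem (by simpa using hD.add _ hf _ h)

theorem calledOff_zero_mem (hD : IsCoherentSet D) {B : Set X} (hB : B.Nonempty) {μ : ℝ}
    (hμ : μ < 0) : calledOff 0 μ B ∈ D := by
  refine hD.gain _ (fun x => ?_) fun h => ?_
  · by_cases hx : x ∈ B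
    · simpa [calledOff_apply_of_mem _ _ hx] using hμ.le
    · simp [calledOff_apply_of_notMem _ _ hx]
  · obtain ⟨x, hx⟩ := hB
    have := calledOff_apply_of_mem 0 μ hx
    simp only [h, Submodule.coe_zero, Pi.zero_apply] at this
    linarith

/-- Lowering the price adds a positive multiple of the indicator of `B`. The zero alternative occurs
when the gamble is constant on `B`; completeness of a set does not rule it out. -/
theorem calledOff_mem_of_lt (hD : IsCoherentSet D) {f : Gamble X} {B : Set X} (hB : B.Nonempty)
    {μ ν : ℝ} (h : μ < ν) (hν : calledOff f ν B ∈ D ∨ calledOff f ν B = 0) :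
    calledOff f μ B ∈ D := by
  have h0 := hD.calledOff_zero_mem hB (sub_neg.2 h)
  rw [calledOff_eq_add f μ ν B]
  rcases hν with hν | hν
  · exact hD.add _ hν _ h0
  · simpa [hν] using h0

theorem sInter {S : Set (Set (Gamble X))} (hS : S.Nonempty) (h : ∀ D ∈ S, IsCoherentSet D) :
    IsCoherentSet (⋂₀ S) where
  gain f hf hf0 D hD := (h D hD).gain f hf hf0
  scale f hf c hc D hD := (h D hD).scale f (hf D hD) c hc
  add f hf g hg D hD := (h D hD).add f (hf D hD) g (hg D hD)
  loss f hf hfS := by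
    obtain ⟨D, hD⟩ := hS
    exact (h D hD).loss f hf (hfS D hD)

theorem sUnion_of_isChain {S : Set (Set (Gamble X))} (hc : IsChain (· ⊆ ·) S) (hS : S.Nonempty)
    (h : ∀ D ∈ S, IsCoherentSet D) : IsCoherentSet (⋃₀ S) where
  gain f hf hf0 := by
    obtain ⟨D, hD⟩ := hS
    exact ⟨D, hD, (h D hD).gain f hf hf0⟩
  scale := by
    rintro f ⟨D, hD, hf⟩ c hc
    exact ⟨D, hD, (h D hD).scale f hf c hc⟩
  add := by
    rintro f ⟨D, hD, hf⟩ g ⟨E, hE, hg⟩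
    rcases hc.total hD hE with hDE | hED
    · exact ⟨E, hE, (h E hE).add f (hDE hf) g hg⟩
    · exact ⟨D, hD, (h D hD).add f hf g (hED hg)⟩
  loss := by
    rintro f hf ⟨D, hD, hfD⟩
    exact (h D hD).loss f hf hfD

/-- A coherent set can be enlarged by a convex cone that does not meet `-D ∪ {0}`. -/
theorem exists_superset_of_cone (hD : IsCoherentSet D) {K : Set (Gamble X)}
    (hsmul : ∀ k ∈ K, ∀ c : ℝ, 0 < c → c • k ∈ K) (hadd : ∀ k ∈ K, ∀ l ∈ K, k + l ∈ K)
    (hK0 : (0 : Gamble X) ∉ K) (hKD : ∀ k ∈ K, -k ∉ D) :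
    ∃ E, IsCoherentSet E ∧ D ⊆ E ∧ K ⊆ E := by
  refine ⟨{f | f ∈ D ∨ f ∈ K ∨ ∃ g ∈ D, ∃ k ∈ K, f = g + k}, ?_, fun f hf => Or.inl hf,
    fun f hf => Or.inr (Or.inl hf)⟩
  -- This secures avoidance of losses: a nonzero `f ≤ 0` has `-f ∈ D`.
  have key : ∀ f, (f ∈ D ∨ f ∈ K ∨ ∃ g ∈ D, ∃ k ∈ K, f = g + k) → f ≠ 0 ∧ -f ∉ D := by
    rintro f (hf | hf | ⟨g, hg, k, hk, rfl⟩)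
    · exact ⟨fun h => hD.zero_notMem (h ▸ hf), hD.neg_notMem hf⟩
    · exact ⟨fun h => hK0 (h ▸ hf), hKD f hf⟩
    · refine ⟨fun h => hKD k hk ?_, fun h => hKD k hk ?_⟩
      · rwa [← eq_neg_of_add_eq_zero_left h]
      · have : -k = g + -(g + k) := by abel
        rw [this]
        exact hD.add _ hg _ h
  refine ⟨fun f hf hf0 => Or.inl (hD.gain f hf hf0), ?_, ?_, fun f hf hfE => ?_⟩
  · rintro f (hf | hf | ⟨g, hg, k, hk, rfl⟩) c hc
    · exact Or.inl (hD.scale f hf c hc)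
    · exact Or.inr (Or.inl (hsmul f hf c hc))
    · exact Or.inr (Or.inr ⟨_, hD.scale g hg c hc, _, hsmul k hk c hc, smul_add c g k⟩)
  · rintro f (hf | hf | ⟨g, hg, k, hk, rfl⟩) f' (hf' | hf' | ⟨g', hg', k', hk', rfl⟩)
    · exact Or.inl (hD.add _ hf _ hf')
    · exact Or.inr (Or.inr ⟨_, hf, _, hf', rfl⟩)
    · exact Or.inr (Or.inr ⟨_, hD.add _ hf _ hg', _, hk', by abel⟩)
    · exact Or.inr (Or.inr ⟨_, hf', _, hf, by abel⟩)
    · exact Or.inr (Or.inl (hadd _ hf _ hf'))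
    · exact Or.inr (Or.inr ⟨_, hg', _, hadd _ hf _ hk', by abel⟩)
    · exact Or.inr (Or.inr ⟨_, hD.add _ hg _ hf', _, hk, by abel⟩)
    · exact Or.inr (Or.inr ⟨_, hg, _, hadd _ hk _ hf', by abel⟩)
    · exact Or.inr (Or.inr ⟨_, hD.add _ hg _ hg', _, hadd _ hk _ hk', by abel⟩)
  · obtain ⟨hf0, hfD⟩ := key f hfE
    exact hfD (hD.gain (-f) (fun x => by simpa using hf x) (neg_ne_zero.2 hf0))

/-- Every coherent set is contained in a complete one. -/
theorem exists_complete_superset (hD : IsCoherentSet D) :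
    ∃ M, IsCoherentSet M ∧ D ⊆ M ∧ ∀ f ∉ M, f = 0 ∨ -f ∈ M := by
  obtain ⟨M, hDM, hM⟩ := zorn_subset_nonempty {E : Set (Gamble X) | IsCoherentSet E}
    (fun S hS hc hne =>
      ⟨⋃₀ S, sUnion_of_isChain hc hne hS, fun E hE => Set.subset_sUnion_of_mem hE⟩)
    D hD
  refine ⟨M, hM.prop, hDM, fun f hf => or_iff_not_imp_left.2 fun hf0 => ?_⟩
  have hMc : IsCoherentSet M := hM.prop
  -- The open ray through `-f` can be adjoined because `f ∉ M` and `f ≠ 0`; maximality then puts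
  -- `-f` in `M`.
  obtain ⟨E, hE, hME, hKE⟩ : ∃ E, IsCoherentSet E ∧ M ⊆ E ∧
      {k | ∃ c : ℝ, 0 < c ∧ k = c • -f} ⊆ E := by
    refine hMc.exists_superset_of_cone ?_ ?_ ?_ ?_
    · rintro _ ⟨c, hc, rfl⟩ d hd
      exact ⟨d * c, mul_pos hd hc, smul_smul d c _⟩
    · rintro _ ⟨c, hc, rfl⟩ _ ⟨d, hd, rfl⟩
      exact ⟨c + d, add_pos hc hd, (add_smul c d _).symm⟩
    · rintro ⟨c, hc, h⟩
      rcases smul_eq_zero.1 h.symm with h | h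
      · exact hc.ne' h
      · exact hf0 (neg_eq_zero.1 h)
    · rintro _ ⟨c, hc, rfl⟩ h
      apply hf
      have := hMc.scale _ h c⁻¹ (inv_pos.2 hc)
      rwa [smul_neg c, neg_neg, smul_smul, inv_mul_cancel₀ hc.ne', one_smul] at this
  exact hM.le_of_ge hE hME (hKE ⟨1, one_pos, (one_smul ℝ _).symm⟩)

end IsCoherentSet

/-! ### Lower previsions derived from coherent sets -/

variable {D : Set (Gamble X)}

theorem le_lowerOf {p : CondPair X} {μ : ℝ} (h : calledOff p.1 μ p.2.1 ∈ D) :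
    (μ : EReal) ≤ lowerOf D p :=
  le_sSup ⟨μ, h, rfl⟩

theorem lowerOf_le_iff {p : CondPair X} {a : EReal} :
    lowerOf D p ≤ a ↔ ∀ μ : ℝ, calledOff p.1 μ p.2.1 ∈ D → (μ : EReal) ≤ a := by
  simp [lowerOf, sSup_le_iff]

theorem lowerOf_mono {E : Set (Gamble X)} (h : D ⊆ E) (p : CondPair X) :
    lowerOf D p ≤ lowerOf E p :=
  lowerOf_le_iff.2 fun _ hμ => le_lowerOf (h hμ)

theorem IsCoherentSet.calledOff_mem_of_lt_lowerOf (hD : IsCoherentSet D) {p : CondPair X} {μ : ℝ}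
    (h : (μ : EReal) < lowerOf D p) : calledOff p.1 μ p.2.1 ∈ D := by
  obtain ⟨_, ⟨ν, hν, rfl⟩, hμν⟩ := lt_sSup_iff.1 h
  exact hD.calledOff_mem_of_lt p.2.2 (EReal.coe_lt_coe_iff.1 hμν) (Or.inl hν)

/-- The lower prevision derived from a complete coherent set is self-conjugate. -/
theorem IsCoherentSet.lowerOf_eq_neg (hD : IsCoherentSet D) (hc : ∀ f ∉ D, f = 0 ∨ -f ∈ D)
    (p : CondPair X) : lowerOf D p = -lowerOf D (-p.1, p.2) := by
  apply le_antisymm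
  · refine lowerOf_le_iff.2 fun μ hμ => EReal.le_neg_of_le_neg (lowerOf_le_iff.2 fun ν hν => ?_)
    rw [← EReal.coe_neg, EReal.coe_le_coe_iff]
    by_contra! h
    refine hD.neg_notMem (hD.calledOff_mem_of_lt p.2.2 h (Or.inl hν)) ?_
    simpa [calledOff_neg] using hμ
  · by_contra! h
    obtain ⟨μ, hμ, h⟩ := EReal.lt_iff_exists_real_btwn.1 h
    obtain ⟨ν, hμν, hν⟩ := EReal.lt_iff_exists_real_btwn.1 h
    -- The price `μ` is rejected, so the negated gamble is in `D` or zero; moving strictly up to `ν`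
    -- gives membership in both cases.
    have hμD : calledOff p.1 μ p.2.1 ∉ D := fun hmem => (le_lowerOf hmem).not_gt hμ
    have hmem : calledOff (-p.1) (-ν) p.2.1 ∈ D := by
      refine hD.calledOff_mem_of_lt p.2.2 (neg_lt_neg (EReal.coe_lt_coe_iff.1 hμν)) ?_
      rw [calledOff_neg, neg_eq_zero]
      exact (hc _ hμD).symm
    have hle := le_lowerOf (D := D) (p := (-p.1, p.2)) hmem
    rw [EReal.coe_neg] at hle
    exact (EReal.neg_le.1 hle).not_gt hν

/-- The value of a lower prevision at a pair is attained by a complete coherent superset. -/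
theorem IsCoherentSet.exists_complete_superset_lowerOf_eq (hD : IsCoherentSet D)
    (p : CondPair X) :
    ∃ M, IsCoherentSet M ∧ D ⊆ M ∧ (∀ f ∉ M, f = 0 ∨ -f ∈ M) ∧ lowerOf M p = lowerOf D p := by
  -- A positive combination of two such gambles is one at the weighted average price, hence still
  -- above the value. If the value is `⊤`, the cone is empty.
  obtain ⟨E, hE, hDE, hKE⟩ : ∃ E, IsCoherentSet E ∧ D ⊆ E ∧
      {k | ∃ c μ : ℝ, 0 < c ∧ lowerOf D p < μ ∧ k = c • -calledOff p.1 μ p.2.1} ⊆ E := by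
    refine hD.exists_superset_of_cone ?_ ?_ ?_ ?_
    · rintro _ ⟨c, μ, hc, hμ, rfl⟩ d hd
      exact ⟨d * c, μ, mul_pos hd hc, hμ, smul_smul d c _⟩
    · rintro _ ⟨c, μ, hc, hμ, rfl⟩ _ ⟨d, ν, hd, hν, rfl⟩
      refine ⟨c + d, (c * μ + d * ν) / (c + d), add_pos hc hd, (lt_min hμ hν).trans_le ?_, ?_⟩
      · rw [← EReal.coe_strictMono.monotone.map_min, EReal.coe_le_coe_iff, le_div_iff₀ (add_pos hc hd)]
        nlinarith [mul_le_mul_of_nonneg_left (min_le_left μ ν) hc.le,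
          mul_le_mul_of_nonneg_left (min_le_right μ ν) hd.le]
      · rw [smul_neg, smul_neg, smul_neg, ← neg_add,
          smul_calledOff_add_smul_calledOff _ _ _ _ (add_pos hc hd).ne']
    · rintro ⟨c, μ, hc, hμ, h⟩
      -- A zero called-off gamble at `μ` would make every price below `μ` acceptable, including some
      -- above the value.
      obtain ⟨ν, hν, hνμ⟩ := EReal.lt_iff_exists_real_btwn.1 hμ
      refine (le_lowerOf (hD.calledOff_mem_of_lt p.2.2 (EReal.coe_lt_coe_iff.1 hνμ)
        (Or.inr ?_))).not_gt hν
      exact neg_eq_zero.1 ((smul_eq_zero.1 h.symm).resolve_left hc.ne')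
    · rintro _ ⟨c, μ, hc, hμ, rfl⟩ h
      refine (le_lowerOf (D := D) (p := p) ?_).not_gt hμ
      have := hD.scale _ h c⁻¹ (inv_pos.2 hc)
      rwa [smul_neg c, neg_neg, smul_smul, inv_mul_cancel₀ hc.ne', one_smul] at this
  obtain ⟨M, hM, hEM, hc⟩ := hE.exists_complete_superset
  refine ⟨M, hM, hDE.trans hEM, hc, le_antisymm ?_ (lowerOf_mono (hDE.trans hEM) p)⟩
  refine lowerOf_le_iff.2 fun μ hμ => ?_
  by_contra! h
  exact hM.neg_notMem hμ (hEM (hKE ⟨1, μ, one_pos, h, (one_smul ℝ _).symm⟩))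

theorem IsCoherentSet.isLinearPrevision_lowerOf (hD : IsCoherentSet D)
    (hc : ∀ f ∉ D, f = 0 ∨ -f ∈ D) :
    IsLinearPrevision (C := (Set.univ : Set (CondPair X))) fun p => lowerOf D p.1 :=
  ⟨fun p => ⟨Set.mem_univ _, hD.lowerOf_eq_neg hc p.1⟩, D, hD, fun _ => rfl⟩

/-- A coherent lower prevision is the minimum of the linear previsions that dominate it. -/
theorem IsCoherent.exists_isLeast {C : Set (CondPair X)} {P₀ : CondLowerPrevision C}
    (h : IsCoherent P₀) :
    ∃ S : Set (FullCondLowerPrevision X), S.Nonempty ∧ (∀ P ∈ S, IsLinearPrevision P) ∧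
      ∀ p : C, IsLeast
        ((fun P : FullCondLowerPrevision X => P ⟨p.1, Set.mem_univ p.1⟩) '' S) (P₀ p) := by
  obtain ⟨D, hD, hP⟩ := h
  refine ⟨{P | IsLinearPrevision P ∧ ∀ q, lowerOf D q.1 ≤ P q}, ?_, fun P hP => hP.1,
    fun p => ⟨?_, ?_⟩⟩
  -- Attainment on `C` would not give non-emptiness, as `C` may be empty.
  · obtain ⟨M, hM, hDM, hc⟩ := hD.exists_complete_superset
    exact ⟨_, hM.isLinearPrevision_lowerOf hc, fun q => lowerOf_mono hDM q.1⟩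
  · obtain ⟨M, hM, hDM, hc, hp⟩ := hD.exists_complete_superset_lowerOf_eq p.1
    exact ⟨_, ⟨hM.isLinearPrevision_lowerOf hc, fun q => lowerOf_mono hDM q.1⟩,
      hp.trans (hP p).symm⟩
  · rintro _ ⟨P, hPS, rfl⟩
    rw [hP p]
    exact hPS.2 ⟨p.1, Set.mem_univ p.1⟩

/-- A lower envelope of coherent lower previsions is coherent. -/
theorem isCoherent_of_eq_sInf {C : Set (CondPair X)} {P₀ : CondLowerPrevision C}
    {S : Set (FullCondLowerPrevision X)} (hS : S.Nonempty) (hc : ∀ P ∈ S, IsCoherent P)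
    (h : ∀ p : C, P₀ p =
      sInf ((fun P : FullCondLowerPrevision X => P ⟨p.1, Set.mem_univ p.1⟩) '' S)) :
    IsCoherent P₀ := by
  choose! D hD hP using hc
  have hcoh : IsCoherentSet (⋂₀ (D '' S)) :=
    IsCoherentSet.sInter (hS.image D) (by rintro _ ⟨P, hPS, rfl⟩; exact hD P hPS)
  refine ⟨_, hcoh, fun p => (h p).trans (le_antisymm ?_ ?_)⟩
  -- A real price below the infimum is below every `P`, so its called-off gamble lies in every `D
  -- P`.
  · by_contra! hlt
    obtain ⟨μ, hμ, hμ'⟩ := EReal.lt_iff_exists_real_btwn.1 hlt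
    refine (le_lowerOf ?_).not_gt hμ
    rintro _ ⟨P, hPS, rfl⟩
    refine (hD P hPS).calledOff_mem_of_lt_lowerOf ?_
    rw [← hP P hPS ⟨p.1, Set.mem_univ p.1⟩]
    exact hμ'.trans_le (sInf_le (Set.mem_image_of_mem _ hPS))
  · refine le_sInf ?_
    rintro _ ⟨P, hPS, rfl⟩
    exact (lowerOf_mono (Set.sInter_subset_of_mem (Set.mem_image_of_mem D hPS)) p.1).trans_eq
      (hP P hPS ⟨p.1, Set.mem_univ p.1⟩).symm

end CondPrev

theorem mainTheorem9 {X : Type*} [Nonempty X] (C : Set (CondPrev.CondPair X))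
    (P₀ : CondPrev.CondLowerPrevision C) :
    (CondPrev.IsCoherent P₀ ↔
      ∃ S : Set (CondPrev.FullCondLowerPrevision X), S.Nonempty ∧
        (∀ P ∈ S, CondPrev.IsLinearPrevision P) ∧
        ∀ p : C, P₀ p =
          sInf ((fun P : CondPrev.FullCondLowerPrevision X => P ⟨p.1, Set.mem_univ p.1⟩) '' S)) ∧
    (CondPrev.IsCoherent P₀ ↔
      ∃ S : Set (CondPrev.FullCondLowerPrevision X), S.Nonempty ∧
        (∀ P ∈ S, CondPrev.IsLinearPrevision P) ∧
        ∀ p : C, IsLeast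
          ((fun P : CondPrev.FullCondLowerPrevision X => P ⟨p.1, Set.mem_univ p.1⟩) '' S)
          (P₀ p)) := by
  refine ⟨⟨fun h => ?_, fun ⟨S, hS, hL, h⟩ => ?_⟩, fun h => h.exists_isLeast,
    fun ⟨S, hS, hL, h⟩ => ?_⟩
  · obtain ⟨S, hS, hL, hm⟩ := h.exists_isLeast
    exact ⟨S, hS, hL, fun p => (hm p).isGLB.sInf_eq.symm⟩
  · exact CondPrev.isCoherent_of_eq_sInf hS (fun P hP => (hL P hP).2) h
  · exact CondPrev.isCoherent_of_eq_sInf hS (fun P hP => (hL P hP).2)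
      fun p => (h p).isGLB.sInf_eq.symm
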